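/- Let $\mathbb K=\mathbb R$ or $\mathbb C$, let $m\ge 2$ be an integer and let $\mathbf p=(p_1,\dots,p_m)\in(1,\infty]^m$. With the convention $1/\infty=0$, write $\left|\tfrac1{\mathbf p}\right|=\tfrac1{p_1}+\cdots+\tfrac1{p_m}$ and suppose that $$\tfrac12\le\left|\tfrac1{\mathbf p}\right|<1 .$$ Let $s$ be the least integer $r$ for which there are $r$ pairwise distinct indices $k_1,\dots,k_r\in\{1,\dots,m\}$ with $$\tfrac12\le\tfrac1{p_{k_1}}+\cdots+\tfrac1{p_{k_r}}<1,$$ and let $k_1,\dots,k_s$ be any $s$ pairwise distinct indices with this property. Then, for every positive integer $n$ and every $m$-linear form $T:\ell_{p_1}^n\times\cdots\times\ell_{p_m}^n\to\mathbb K$, $$\left(\sum_{j_1,\dots,j_m=1}^n\left|T(e_{j_1},\dots,e_{j_m})\right|^{\frac1{1-|1/\mathbf p|}}\right)^{1-|1/\mathbf p|}\le 2^{(s-1)\left[1-\left(\frac1{p_{k_1}}+\cdots+\frac1{p_{k_s}}\right)\right]}\,\|T\| .$$ Here $\ell_q^n$ is $\mathbb K^n$ with the $\ell_q$-norm (the sup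 norm if $q=\infty$), $e_1,\dots,e_n$ are the canonical vectors of $\mathbb K^n$, and $\|T\|=\sup\{|T(x_1,\dots,x_m)|:\|x_1\|,\dots,\|x_m\|\le1\}$. -/

import Mathlib

open scoped ENNReal

/-- The partial sum `∑_{k ∈ S} 1 / p_k` of reciprocals of the exponents, as a real number, with the
convention `1 / ∞ = 0`. For `S = Finset.univ` it is `|1/p|`. -/
noncomputable def recipSum {m : ℕ} (p : Fin m → ℝ≥0∞) (S : Finset (Fin m)) : ℝ :=
  ∑ k ∈ S, ((p k)⁻¹).toReal

/-- The sizes `r` of sets `{k_1, …, k_r}` of `r` distinct indices with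
`1/2 ≤ 1/p_{k_1} + ⋯ + 1/p_{k_r} < 1`. -/
def admissibleSizes {m : ℕ} (p : Fin m → ℝ≥0∞) : Set ℕ :=
  {r | ∃ S : Finset (Fin m), S.card = r ∧ 1 / 2 ≤ recipSum p S ∧ recipSum p S < 1}

/-- If `1/2 ≤ |1/p| < 1`, then the whole index set is admissible, so a least size exists. -/
theorem admissibleSizes_nonempty {m : ℕ} (p : Fin m → ℝ≥0∞)
    (h₁ : 1 / 2 ≤ recipSum p Finset.univ) (h₂ : recipSum p Finset.univ < 1) :
    (admissibleSizes p).Nonempty :=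
  ⟨_, Finset.univ, rfl, h₁, h₂⟩

/-- The canonical vector `e_j` of `ℓ_q^n`. -/
noncomputable def stdVec (𝕜 : Type*) [RCLike 𝕜] {n : ℕ} (q : ℝ≥0∞) (j : Fin n) :
    PiLp q (fun _ : Fin n => 𝕜) :=
  PiLp.single q j 1

/-- `‖T‖ = sup {|T(x_1, …, x_m)| : ‖x_1‖, …, ‖x_m‖ ≤ 1}` for an `m`-linear form `T` on
`ℓ_{p_1}^n × ⋯ × ℓ_{p_m}^n`. -/
noncomputable def formNorm {𝕜 : Type*} [RCLike 𝕜] {m n : ℕ} {p : Fin m → ℝ≥0∞}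
    (T : MultilinearMap 𝕜 (fun k : Fin m => PiLp (p k) (fun _ : Fin n => 𝕜)) 𝕜) : ℝ :=
  sSup {r : ℝ | ∃ x : (k : Fin m) → PiLp (p k) (fun _ : Fin n => 𝕜),
    (∀ k, ‖x k‖ ≤ 1) ∧ r = ‖T x‖}

/-- The supremum defining `formNorm` is taken over a set that is bounded above. -/
theorem formNorm_bddAbove {𝕜 : Type*} [RCLike 𝕜] {m n : ℕ} {p : Fin m → ℝ≥0∞}
    (hp : ∀ k, 1 < p k)
    (T : MultilinearMap 𝕜 (fun k : Fin m => PiLp (p k) (fun _ : Fin n => 𝕜)) 𝕜) :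
    BddAbove {r : ℝ | ∃ x : (k : Fin m) → PiLp (p k) (fun _ : Fin n => 𝕜),
      (∀ k, ‖x k‖ ≤ 1) ∧ r = ‖T x‖} := by
  refine ⟨∑ j : Fin m → Fin n, ‖T fun k => stdVec 𝕜 (p k) (j k)‖, ?_⟩
  rintro r ⟨x, hx, rfl⟩
  have hexp : x = fun k => ∑ j : Fin n, (x k) j • stdVec 𝕜 (p k) j := by
    funext k
    ext i
    simp [stdVec, Pi.single_apply]
  rw [hexp, MultilinearMap.map_sum]
  refine (norm_sum_le _ _).trans (Finset.sum_le_sum fun j _ => ?_)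
  rw [MultilinearMap.map_smul_univ, norm_smul]
  refine mul_le_of_le_one_left (norm_nonneg _) ?_
  rw [norm_prod]
  refine Finset.prod_le_one (fun k _ => norm_nonneg _) fun k _ => ?_
  have : Fact (1 ≤ p k) := ⟨(hp k).le⟩
  exact (PiLp.norm_apply_le (x k) (j k)).trans (hx k)

/-!
Write `aₖ = 1 / pₖ` and `tⱼ = T(e_{j₁}, …, e_{jₘ})`. Points of the unit ball of `ℓ_{p_k}` are
controlled by a probability vector `wₖ` through `|zₖ| ≤ wₖ ^ aₖ`, and this is how the norm of `T`
enters (`FormBound`).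

Let `q` be the probability vector on multi-indices that is proportional to `|t| ^ λ`, with
`1 / λ = 1 - ∑ a`, and let the weights `wₖ` be the marginals of `q`. Inserting random signs times
`wₗ ^ aₗ` in a variable `l` and applying Khinchine's inequality in `L^ρ`, `1 ≤ ρ ≤ 2`, turns a mixed
`ℓ_ρ(ℓ_2)` estimate for the other variables into an `ℓ_ρ(ℓ_2)` estimate for the weighted array
(`mixed_norm_le_of_contract`). Taking logarithms and using Jensen's inequality with respect to `q`
(`sum_log_le_log_of_mixed_norm_le`) leaves a linear inequality between the logarithm of
`‖t‖_λ`, the logarithm of `‖T‖`, and the entropies of `q` and of its marginals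
(`entropy_inequality`). When the outer variable is the one whose marginal has the largest entropy,
the entropies contribute with the right sign and drop out. The same argument, with another `q`,
builds the mixed estimates by induction on the number of variables (`MixedBound.step`).

Each added variable costs the constant of Khinchine's inequality for its exponent (`khinchine`):
`√2` for `ρ = 1`, obtained from the spectral gap of even functions on the discrete cube, and a
constant that tends to `1` as `ρ` increases to `2`, obtained from fourth moments. The exponent `ρ`
increases with the number of variables, and if `S` is a minimal admissible set the product of the
constants is at most `2 ^ ((s - 1) (1 - ∑_S a))` (`coeffBound_two`, `coeffBound_add_three`). A
variable outside `S` is added at no cost, because the exponent is then at least `2`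
(`CoeffBound.add_variable`).
-/

/-! ### Averages over signs and Khinchine's inequality -/

/-- The vector of signs `±1` coded by a Boolean vector. -/
def signVec {n : ℕ} (ε : Fin n → Bool) : Fin n → ℝ := fun i => if ε i then 1 else -1

/-- The mean of `F` over the `2 ^ n` sign vectors in `{-1, 1}ⁿ`. -/
noncomputable def signAvg {n : ℕ} (F : (Fin n → ℝ) → ℝ) : ℝ :=
  (∑ ε : Fin n → Bool, F (signVec ε)) / 2 ^ n

theorem signAvg_succ {n : ℕ} (F : (Fin (n + 1) → ℝ) → ℝ) :
    signAvg F =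
      (signAvg (fun e => F (Fin.cons 1 e)) + signAvg (fun e => F (Fin.cons (-1) e))) / 2 := by
  have key : ∀ (b : Bool) (ε : Fin n → Bool), signVec (Fin.cons b ε : Fin (n + 1) → Bool)
      = Fin.cons (if b then 1 else -1) (signVec ε) := by
    intro b ε
    funext i
    refine Fin.cases ?_ (fun i => ?_) i <;> simp [signVec]
  unfold signAvg
  rw [← (Fin.consEquiv (fun _ : Fin (n + 1) => Bool)).sum_comp, Fintype.sum_prod_type,
    Fintype.sum_bool]
  have hc : ∀ (b : Bool) (ε : Fin n → Bool),
      Fin.consEquiv (fun _ : Fin (n + 1) => Bool) (b, ε) = Fin.cons b ε := fun _ _ => rfl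
  simp only [hc, key, if_true, Bool.false_eq_true, if_false]
  rw [pow_succ]
  field_simp

theorem signAvg_add {n : ℕ} (F G : (Fin n → ℝ) → ℝ) :
    signAvg (fun e => F e + G e) = signAvg F + signAvg G := by
  simp [signAvg, Finset.sum_add_distrib, add_div]

theorem signAvg_sub {n : ℕ} (F G : (Fin n → ℝ) → ℝ) :
    signAvg (fun e => F e - G e) = signAvg F - signAvg G := by
  simp [signAvg, Finset.sum_sub_distrib, sub_div]

theorem signAvg_const_mul {n : ℕ} (c : ℝ) (F : (Fin n → ℝ) → ℝ) :
    signAvg (fun e => c * F e) = c * signAvg F := by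
  simp [signAvg, ← Finset.mul_sum, mul_div_assoc]

theorem signAvg_const {n : ℕ} (c : ℝ) : signAvg (fun _ : Fin n → ℝ => c) = c := by
  simp [signAvg]

theorem signAvg_sum {n : ℕ} {ι : Type*} (s : Finset ι) (F : ι → (Fin n → ℝ) → ℝ) :
    signAvg (fun e => ∑ i ∈ s, F i e) = ∑ i ∈ s, signAvg (F i) := by
  simp only [signAvg]
  rw [Finset.sum_comm, Finset.sum_div]

theorem abs_signVec {n : ℕ} (ε : Fin n → Bool) (i : Fin n) : |signVec ε i| = 1 := by
  unfold signVec
  split_ifs <;> simp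

theorem signAvg_mono {n : ℕ} {F G : (Fin n → ℝ) → ℝ}
    (h : ∀ e : Fin n → ℝ, (∀ i, |e i| = 1) → F e ≤ G e) : signAvg F ≤ signAvg G := by
  unfold signAvg
  gcongr with ε
  exact h _ (abs_signVec ε)

theorem signAvg_nonneg {n : ℕ} {F : (Fin n → ℝ) → ℝ} (h : ∀ e, 0 ≤ F e) : 0 ≤ signAvg F := by
  unfold signAvg
  exact div_nonneg (Finset.sum_nonneg fun ε _ => h (signVec ε)) (by positivity)

theorem neg_cons_real {n : ℕ} (x : ℝ) (e : Fin n → ℝ) :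
    -(Fin.cons x e : Fin (n + 1) → ℝ) = Fin.cons (-x) (-e) := by
  funext i
  refine Fin.cases ?_ (fun i => ?_) i <;> simp

theorem signAvg_comp_neg {n : ℕ} (F : (Fin n → ℝ) → ℝ) :
    signAvg (fun e => F (-e)) = signAvg F := by
  induction n with
  | zero =>
    congr 1
    funext e
    congr 1
    exact Subsingleton.elim _ _
  | succ n ih =>
    rw [signAvg_succ, signAvg_succ F]
    simp only [neg_cons_real, neg_neg]
    rw [ih (fun e => F (Fin.cons (-1) e)), ih (fun e => F (Fin.cons 1 e)), add_comm]

/-- Jensen's inequality for powers. -/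
theorem rpow_signAvg_le {n : ℕ} {F : (Fin n → ℝ) → ℝ} (hF : ∀ e, 0 ≤ F e) {r : ℝ} (hr : 1 ≤ r) :
    signAvg F ^ r ≤ signAvg fun e => F e ^ r := by
  have h0 := signAvg_nonneg hF
  rcases h0.eq_or_lt with h | h
  · rw [← h, Real.zero_rpow (by linarith)]
    exact signAvg_nonneg fun e => Real.rpow_nonneg (hF e) _
  · set M := signAvg F with hM
    -- average the tangent line inequality for `x ↦ x ^ r` at the mean
    have key : signAvg (fun e => M ^ r * (1 - r) + M ^ r * r / M * F e)
        ≤ signAvg fun e => F e ^ r := by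
      refine signAvg_mono fun e _ => ?_
      have h1 := one_add_mul_self_le_rpow_one_add (s := F e / M - 1)
        (by have := div_nonneg (hF e) h0; linarith) hr
      rw [add_sub_cancel, Real.div_rpow (hF e) h0, le_div_iff₀ (Real.rpow_pos_of_pos h r)] at h1
      calc _ = (1 + r * (F e / M - 1)) * M ^ r := by field_simp; ring
        _ ≤ _ := h1
    rw [signAvg_add, signAvg_const, signAvg_const_mul, ← hM] at key
    have e1 : M ^ r * (1 - r) + M ^ r * r / M * M = M ^ r := by field_simp; ring
    rwa [e1] at key

/-- The Dirichlet form of the discrete cube, half the sum over the coordinates of the mean of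
`f (f - f ∘ flip)`; its eigenvalue on a Walsh character is the degree of the character. -/
noncomputable def signEnergy {n : ℕ} (f : (Fin n → ℝ) → ℝ) : ℝ :=
  (∑ i, signAvg fun e => f e * (f e - f (Function.update e i (-(e i))))) / 2

theorem signEnergy_succ {n : ℕ} (f : (Fin (n + 1) → ℝ) → ℝ) :
    signEnergy f = signEnergy (fun e => (f (Fin.cons 1 e) + f (Fin.cons (-1) e)) / 2)
      + signEnergy (fun e => (f (Fin.cons 1 e) - f (Fin.cons (-1) e)) / 2)
      + signAvg fun e => ((f (Fin.cons 1 e) - f (Fin.cons (-1) e)) / 2) ^ 2 := by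
  unfold signEnergy
  rw [Fin.sum_univ_succ]
  simp only [signAvg_succ, Fin.update_cons_zero, Fin.cons_zero, Fin.cons_succ, ← Fin.cons_update,
    neg_neg]
  have h0 : (signAvg (fun e => f (Fin.cons 1 e) * (f (Fin.cons 1 e) - f (Fin.cons (-1) e)))
      + signAvg (fun e => f (Fin.cons (-1) e) * (f (Fin.cons (-1) e) - f (Fin.cons 1 e)))) / 2
      = 2 * signAvg fun e : Fin n → ℝ => ((f (Fin.cons 1 e) - f (Fin.cons (-1) e)) / 2) ^ 2 := by
    rw [← signAvg_add, ← signAvg_const_mul, div_eq_inv_mul, ← signAvg_const_mul]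
    congr 1; funext e; ring
  rw [h0, add_div, mul_div_assoc, add_comm, mul_div_cancel₀ _ two_ne_zero, ← add_div,
    ← Finset.sum_add_distrib]
  congr 2
  refine Finset.sum_congr rfl fun i _ => ?_
  rw [← signAvg_add, ← signAvg_add, div_eq_inv_mul, ← signAvg_const_mul]
  congr 1; funext e; ring

/-- A spectral gap inequality on the cube: decomposing `f` into Walsh characters, degree `0`
contributes nothing, odd degrees at least `1`, and positive even degrees at least `2`. -/
theorem signEnergy_ge {n : ℕ} (f : (Fin n → ℝ) → ℝ) :
    3 / 2 * signAvg (fun e => f e ^ 2) + 1 / 2 * signAvg (fun e => f e * f (-e))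
      - 2 * signAvg f ^ 2 ≤ signEnergy f := by
  induction n with
  | zero =>
    have h : ∀ e : Fin 0 → ℝ, f e = f 0 := fun e => by rw [Subsingleton.elim e 0]
    simp only [h, signEnergy, signAvg_const]
    rw [show signAvg f = f 0 by rw [← signAvg_const (n := 0) (f 0)]; congr 1; funext e; exact h e]
    simp only [Finset.univ_eq_empty, Finset.sum_empty]
    nlinarith
  | succ n ih =>
    set g : (Fin n → ℝ) → ℝ := fun e => (f (Fin.cons 1 e) + f (Fin.cons (-1) e)) / 2 with hg
    set h : (Fin n → ℝ) → ℝ := fun e => (f (Fin.cons 1 e) - f (Fin.cons (-1) e)) / 2 with hh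
    have e0 : signEnergy f = signEnergy g + signEnergy h + signAvg fun e => h e ^ 2 :=
      signEnergy_succ f
    have e1 : signAvg f = signAvg g := by
      rw [signAvg_succ, ← signAvg_add, div_eq_inv_mul, ← signAvg_const_mul]
      congr 1; funext e; simp only [hg]; ring
    have e2 : signAvg (fun e => f e ^ 2) =
        signAvg (fun e => g e ^ 2) + signAvg fun e => h e ^ 2 := by
      rw [signAvg_succ, ← signAvg_add, ← signAvg_add, div_eq_inv_mul, ← signAvg_const_mul]
      congr 1; funext e; simp only [hg, hh]; ring
    have e3 : signAvg (fun e => f e * f (-e))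
        = signAvg (fun e => g e * g (-e)) - signAvg fun e => h e * h (-e) := by
      rw [signAvg_succ, ← signAvg_add, ← signAvg_sub, div_eq_inv_mul, ← signAvg_const_mul]
      congr 1; funext e; simp only [neg_cons_real, neg_neg, hg, hh]; ring
    have e4 : 2 * signAvg h ^ 2 ≤ signAvg (fun e => h e ^ 2) + signAvg fun e => h e * h (-e) := by
      -- Jensen for the square of the even part of `h`
      have k1 : signAvg (fun e => h e + h (-e)) = 2 * signAvg h := by
        rw [signAvg_add, signAvg_comp_neg]; ring
      have k2 : signAvg (fun e => (h e + h (-e)) ^ 2)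
          = 2 * (signAvg (fun e => h e ^ 2) + signAvg fun e => h e * h (-e)) := by
        have : signAvg (fun e => (h e + h (-e)) ^ 2)
            = signAvg (fun e => h e ^ 2) + signAvg (fun e => h (-e) ^ 2)
              + 2 * signAvg fun e => h e * h (-e) := by
          rw [← signAvg_add, ← signAvg_const_mul, ← signAvg_add]
          congr 1; funext e; ring
        rw [this, signAvg_comp_neg fun e => h e ^ 2]; ring
      have k3 : 0 ≤ signAvg fun e => ((h e + h (-e)) - 2 * signAvg h) ^ 2 :=
        signAvg_nonneg fun e => sq_nonneg _
      have k4 : signAvg (fun e => ((h e + h (-e)) - 2 * signAvg h) ^ 2)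
          = signAvg (fun e => (h e + h (-e)) ^ 2)
            - (4 * signAvg h) * signAvg (fun e => h e + h (-e)) + 4 * signAvg h ^ 2 := by
        rw [← signAvg_const_mul (4 * signAvg h), ← signAvg_sub]
        rw [← signAvg_const (n := n) (4 * signAvg h ^ 2), ← signAvg_add]
        congr 1; funext e; ring
      rw [k4, k1, k2] at k3
      nlinarith
    have := ih g
    have := ih h
    rw [e0, e1, e2, e3]
    linarith

section Khinchine

variable {𝕜 : Type*} [RCLike 𝕜] {E : Type*} [NormedAddCommGroup E] [InnerProductSpace 𝕜 E]

theorem sum_cons_smul {n : ℕ} (x : ℝ) (e : Fin n → ℝ) (v : Fin (n + 1) → E) :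
    ∑ i, (((Fin.cons x e : Fin (n + 1) → ℝ) i : ℝ) : 𝕜) • v i
      = (x : 𝕜) • v 0 + ∑ i, ((e i : ℝ) : 𝕜) • v i.succ := by
  rw [Fin.sum_univ_succ]
  simp

theorem signAvg_norm_sq {n : ℕ} (v : Fin n → E) :
    signAvg (fun e => ‖∑ i, ((e i : ℝ) : 𝕜) • v i‖ ^ 2) = ∑ i, ‖v i‖ ^ 2 := by
  induction n with
  | zero => simp [signAvg]
  | succ n ih =>
    rw [signAvg_succ, Fin.sum_univ_succ, ← ih, ← signAvg_add, div_eq_inv_mul, ← signAvg_const_mul,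
      ← signAvg_const (n := n) (‖v 0‖ ^ 2), ← signAvg_add]
    congr 1; funext e
    simp only [sum_cons_smul]
    have := parallelogram_law_with_norm 𝕜 (∑ i, ((e i : ℝ) : 𝕜) • v i.succ) (v 0)
    simp only [RCLike.ofReal_one, one_smul, RCLike.ofReal_neg, neg_smul]
    rw [add_comm (v 0), neg_add_eq_sub]
    nlinarith

theorem signAvg_norm_pow_four_le {n : ℕ} (v : Fin n → E) :
    signAvg (fun e => ‖∑ i, ((e i : ℝ) : 𝕜) • v i‖ ^ 4) ≤ 3 * (∑ i, ‖v i‖ ^ 2) ^ 2 := by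
  induction n with
  | zero => simp [signAvg]
  | succ n ih =>
    have hs := signAvg_norm_sq (𝕜 := 𝕜) fun i : Fin n => v i.succ
    have hi := ih fun i => v i.succ
    rw [signAvg_succ, Fin.sum_univ_succ, ← signAvg_add, div_eq_inv_mul, ← signAvg_const_mul]
    set Q := ∑ i : Fin n, ‖v i.succ‖ ^ 2
    have hQ : 0 ≤ Q := Finset.sum_nonneg fun i _ => sq_nonneg _
    calc _ ≤ signAvg (fun e => ‖∑ i : Fin n, ((e i : ℝ) : 𝕜) • v i.succ‖ ^ 4
          + (6 * ‖v 0‖ ^ 2) * ‖∑ i : Fin n, ((e i : ℝ) : 𝕜) • v i.succ‖ ^ 2 + ‖v 0‖ ^ 4) := by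
          refine signAvg_mono fun e _ => ?_
          simp only [sum_cons_smul, RCLike.ofReal_one, one_smul, RCLike.ofReal_neg, neg_smul]
          set y := ∑ i : Fin n, ((e i : ℝ) : 𝕜) • v i.succ
          rw [add_comm (v 0), neg_add_eq_sub]
          have h1 := norm_add_sq (𝕜 := 𝕜) y (v 0)
          have h2 := norm_sub_sq (𝕜 := 𝕜) y (v 0)
          have h3 : RCLike.re (inner 𝕜 y (v 0)) ^ 2 ≤ (‖y‖ * ‖v 0‖) ^ 2 :=
            sq_le_sq' (by
              have := (abs_le.1 ((RCLike.abs_re_le_norm (inner 𝕜 y (v 0))).trans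
                (norm_inner_le_norm y (v 0)))).1
              linarith) ((RCLike.re_le_norm _).trans (norm_inner_le_norm y (v 0)))
          have h4 : ‖y + v 0‖ ^ 4 = (‖y + v 0‖ ^ 2) ^ 2 := by ring
          have h5 : ‖y - v 0‖ ^ 4 = (‖y - v 0‖ ^ 2) ^ 2 := by ring
          rw [h4, h5, h1, h2]
          nlinarith
      _ = signAvg (fun e => ‖∑ i : Fin n, ((e i : ℝ) : 𝕜) • v i.succ‖ ^ 4)
          + (6 * ‖v 0‖ ^ 2) * Q + ‖v 0‖ ^ 4 := by
          rw [signAvg_add, signAvg_add, signAvg_const_mul, hs, signAvg_const]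
      _ ≤ _ := by nlinarith [sq_nonneg (‖v 0‖ ^ 2), mul_nonneg hQ (sq_nonneg ‖v 0‖)]

/-- The `L¹`-`L²` Khinchine inequality with its best constant `√2`. The function
`f = ‖∑ eᵢ vᵢ‖` is even, and the triangle inequality bounds its energy by its second moment,
so the spectral gap of even functions applies. -/
theorem sum_norm_sq_le_two_mul_signAvg_sq {n : ℕ} (v : Fin n → E) :
    ∑ i, ‖v i‖ ^ 2 ≤ 2 * signAvg (fun e => ‖∑ i, ((e i : ℝ) : 𝕜) • v i‖) ^ 2 := by
  set f : (Fin n → ℝ) → ℝ := fun e => ‖∑ i, ((e i : ℝ) : 𝕜) • v i‖ with hf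
  have hQ : signAvg (fun e => f e ^ 2) = ∑ i, ‖v i‖ ^ 2 := signAvg_norm_sq v
  have heven : ∀ e, f (-e) = f e := fun e => by
    simp only [hf, Pi.neg_apply, RCLike.ofReal_neg, neg_smul, Finset.sum_neg_distrib, norm_neg]
  have h1 := signEnergy_ge f
  simp only [heven, ← sq] at h1
  have h2 : signEnergy f ≤ signAvg (fun e => f e ^ 2) := by
    unfold signEnergy
    rw [← signAvg_sum, div_eq_inv_mul, ← signAvg_const_mul]
    refine signAvg_mono fun e _ => ?_
    rw [← Finset.mul_sum, Finset.sum_sub_distrib]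
    -- the sum over `i` of the vectors with the sign `i` flipped is `n - 2` times the original one
    have h3 : ((n : ℝ) - 2) * f e ≤ ∑ i, f (Function.update e i (-(e i))) := by
      have hup : ∀ i, ∑ j, (((Function.update e i (-(e i))) j : ℝ) : 𝕜) • v j
          = (∑ j, ((e j : ℝ) : 𝕜) • v j) - (2 : 𝕜) • ((e i : ℝ) : 𝕜) • v i := by
        intro i
        rw [eq_sub_iff_add_eq, ← Finset.add_sum_erase _ _ (Finset.mem_univ i),
          ← Finset.add_sum_erase _ (fun j => ((e j : ℝ) : 𝕜) • v j) (Finset.mem_univ i)]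
        rw [Finset.sum_congr rfl (g := fun j => ((e j : ℝ) : 𝕜) • v j) (fun j hj => by
          rw [Function.update_of_ne (Finset.ne_of_mem_erase hj)])]
        simp only [Function.update_self, RCLike.ofReal_neg, neg_smul, two_smul]
        abel
      calc ((n : ℝ) - 2) * f e ≤ ‖((((n : ℝ) - 2 : ℝ)) : 𝕜) • ∑ j, ((e j : ℝ) : 𝕜) • v j‖ := by
            rw [norm_smul, RCLike.norm_ofReal]
            exact mul_le_mul_of_nonneg_right (le_abs_self _) (norm_nonneg _)
        _ = ‖∑ i, ∑ j, (((Function.update e i (-(e i))) j : ℝ) : 𝕜) • v j‖ := by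
            congr 1
            simp only [hup, Finset.sum_sub_distrib, Finset.sum_const, Finset.card_univ,
              Fintype.card_fin, ← Finset.smul_sum]
            rw [RCLike.ofReal_sub, sub_smul, RCLike.ofReal_natCast, Nat.cast_smul_eq_nsmul]
            rw [RCLike.ofReal_ofNat]
        _ ≤ _ := norm_sum_le _ _
    have h4 : 0 ≤ f e := norm_nonneg _
    simp only [Finset.sum_const, Finset.card_univ, Fintype.card_fin, nsmul_eq_mul]
    nlinarith
  rw [hQ] at h1 h2
  linarith

/-- Khinchine's inequality in `L^r` for vectors of a Hilbert space. The constant `2 ^ γ` may be `√2`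
for each `r ∈ [1, 2]`; the other admissible exponent vanishes at `r = 2`. -/
theorem khinchine {n : ℕ} (v : Fin n → E) {r γ : ℝ} (hr₁ : 1 ≤ r) (hr₂ : r ≤ 2)
    (hγ : min (1 / 2) (8 / 5 * (r⁻¹ - 1 / 2)) ≤ γ) :
    (∑ i, ‖v i‖ ^ 2) ^ (r / 2) ≤
      ((2 : ℝ) ^ γ) ^ r * signAvg (fun e => ‖∑ i, ((e i : ℝ) : 𝕜) • v i‖ ^ r) := by
  set f : (Fin n → ℝ) → ℝ := fun e => ‖∑ i, ((e i : ℝ) : 𝕜) • v i‖ with hf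
  have hf0 : ∀ e, 0 ≤ f e := fun e => norm_nonneg _
  set Q := ∑ i, ‖v i‖ ^ 2 with hQd
  have hQ0 : 0 ≤ Q := Finset.sum_nonneg fun i _ => sq_nonneg _
  have hr0 : 0 < r := by linarith
  have hE0 : 0 ≤ signAvg fun e => f e ^ r := signAvg_nonneg fun e => Real.rpow_nonneg (hf0 e) _
  rw [← Real.rpow_mul (by norm_num)]
  rcases min_le_iff.1 hγ with h | h
  · have h1 : Q ≤ 2 * signAvg f ^ 2 := sum_norm_sq_le_two_mul_signAvg_sq v
    have hm : 0 ≤ signAvg f := signAvg_nonneg hf0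
    calc Q ^ (r / 2) ≤ (2 * signAvg f ^ 2) ^ (r / 2) := by gcongr
      _ = 2 ^ (1 / 2 * r) * signAvg f ^ r := by
          rw [Real.mul_rpow (by norm_num) (by positivity), ← Real.rpow_natCast, ← Real.rpow_mul hm]
          congr 2 <;> push_cast <;> ring
      _ ≤ 2 ^ (γ * r) * signAvg fun e => f e ^ r := by
          gcongr
          · norm_num
          · exact rpow_signAvg_le hf0 hr₁
  · rcases hQ0.eq_or_lt with h0 | h0
    · rw [← h0, Real.zero_rpow (by positivity)]
      positivity
    have h2 : signAvg (fun e => f e ^ 2) = Q := signAvg_norm_sq v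
    have h4 : signAvg (fun e => f e ^ 4) ≤ 3 * Q ^ 2 := signAvg_norm_pow_four_le v
    -- `2` lies between `r` and `4`, with weights `x` and `y`
    set x := 2 / (4 - r) with hx
    set y := (2 - r) / (4 - r) with hy
    have hr4 : 0 < 4 - r := by linarith
    have hx0 : 0 < x := by positivity
    have hy0 : 0 ≤ y := div_nonneg (by linarith) hr4.le
    have hxy : x + y = 1 := by rw [hx, hy]; field_simp; ring
    have hyx : y / x = 1 - r / 2 := by rw [hx, hy]; field_simp
    set s : ℝ := 3 ^ (1 - r / 2) with hs
    have hs0 : 0 < s := by positivity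
    have hrx : r * x + 4 * y = 2 := by rw [hx, hy]; field_simp; ring
    have hpt : ∀ e, f e ^ 2 / Q ≤
        x * (s * (f e ^ r / Q ^ (r / 2))) + y * (f e ^ 4 / (3 * Q ^ 2)) := by
      intro e
      have key := Real.geom_mean_le_arith_mean2_weighted hx0.le hy0
        (p₁ := s * (f e ^ r / Q ^ (r / 2))) (p₂ := f e ^ 4 / (3 * Q ^ 2))
        (by have := hf0 e; positivity) (by have := hf0 e; positivity) hxy
      refine le_trans (le_of_eq ?_) key
      have hfe := hf0 e
      have a1 : (f e ^ 4) ^ y = f e ^ (4 * y) := by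
        rw [← Real.rpow_natCast, ← Real.rpow_mul hfe]; norm_num
      have a2 : (Q ^ 2) ^ y = Q ^ (2 * y) := by
        rw [← Real.rpow_natCast, ← Real.rpow_mul hQ0]; norm_num
      have a3 : s ^ x = 3 ^ y := by
        rw [hs, ← Real.rpow_mul (by norm_num), ← hyx]; congr 1; field_simp
      rw [Real.mul_rpow hs0.le (by positivity), Real.div_rpow (by positivity) (by positivity),
        Real.div_rpow (by positivity) (by positivity), Real.mul_rpow (by norm_num) (by positivity),
        a1, a2, a3, ← Real.rpow_mul hfe, ← Real.rpow_mul hQ0]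
      have b1 : f e ^ 2 = f e ^ (r * x) * f e ^ (4 * y) := by
        rw [← Real.rpow_add_of_nonneg hfe (by positivity) (by positivity), hrx]; norm_cast
      have b2 : Q = Q ^ (r / 2 * x) * Q ^ (2 * y) := by
        rw [← Real.rpow_add_of_nonneg hQ0 (by positivity) (by positivity),
          show r / 2 * x + 2 * y = 1 by linarith, Real.rpow_one]
      have b3 : (0 : ℝ) < 3 ^ y := by positivity
      rw [b1]
      nth_rewrite 1 [b2]
      field_simp
    have hav := signAvg_mono fun e _ => hpt e
    simp only [div_eq_inv_mul] at hav
    rw [signAvg_add] at hav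
    simp only [signAvg_const_mul] at hav
    rw [h2, inv_mul_cancel₀ h0.ne'] at hav
    have h5 : (3 * Q ^ 2)⁻¹ * signAvg (fun e => f e ^ 4) ≤ 1 := by
      rw [inv_mul_le_iff₀ (by positivity), mul_one]; exact h4
    have h6 : y * ((3 * Q ^ 2)⁻¹ * signAvg (fun e => f e ^ 4)) ≤ y := by
      simpa using mul_le_mul_of_nonneg_left h5 hy0
    have h7 : x * 1 ≤ x * (s * ((Q ^ (r / 2))⁻¹ * signAvg fun e => f e ^ r)) := by
      rw [← div_eq_inv_mul r 2] at hav
      linarith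
    have h8 := le_of_mul_le_mul_left h7 hx0
    have h9 : Q ^ (r / 2) ≤ s * signAvg fun e => f e ^ r := by
      have hQr : 0 < Q ^ (r / 2) := by positivity
      calc Q ^ (r / 2) = Q ^ (r / 2) * 1 := (mul_one _).symm
        _ ≤ Q ^ (r / 2) * (s * ((Q ^ (r / 2))⁻¹ * signAvg fun e => f e ^ r)) := by gcongr
        _ = _ := by field_simp
    refine h9.trans (mul_le_mul_of_nonneg_right ?_ hE0)
    -- the factor `8 / 5` exceeds `log 3 / log 2`, because `3 ^ 5 ≤ 2 ^ 8`
    calc s = (3 ^ (5 : ℝ)) ^ ((1 - r / 2) / 5) := by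
          rw [hs, ← Real.rpow_mul (by norm_num)]; congr 1; ring
      _ ≤ (2 ^ (8 : ℝ)) ^ ((1 - r / 2) / 5) := by
          apply Real.rpow_le_rpow (by positivity) (by norm_num)
          apply div_nonneg _ (by norm_num); linarith
      _ = 2 ^ (8 / 5 * (r⁻¹ - 1 / 2) * r) := by
          rw [← Real.rpow_mul (by norm_num)]; congr 1; field_simp
      _ ≤ 2 ^ (γ * r) := by gcongr; norm_num

end Khinchine

/-! ### A variational inequality for mixed norms -/

/-- The image of a mass distribution `q` under `π`. -/
noncomputable def marginal {J X : Type*} [Fintype J] [DecidableEq X] (π : J → X) (q : J → ℝ)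
    (x : X) : ℝ :=
  ∑ j with π j = x, q j

section Marginal

variable {J X : Type*} [Fintype J] [DecidableEq X] {π : J → X} {q : J → ℝ}

theorem marginal_mem_stdSimplex [Fintype X] (hq : q ∈ stdSimplex ℝ J) :
    marginal π q ∈ stdSimplex ℝ X :=
  ⟨fun _ => Finset.sum_nonneg fun j _ => hq.1 j,
    (Finset.sum_fiberwise Finset.univ π q).trans hq.2⟩

theorem le_marginal (hq : ∀ j, 0 ≤ q j) (j : J) : q j ≤ marginal π q (π j) :=
  Finset.single_le_sum (f := q) (fun j _ => hq j) (by simp)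

theorem sum_mul_comp_eq_sum_marginal [Fintype X] (φ : X → ℝ) :
    ∑ j, q j * φ (π j) = ∑ x, marginal π q x * φ x := by
  rw [← Finset.sum_fiberwise Finset.univ π]
  refine Finset.sum_congr rfl fun x _ => ?_
  rw [marginal, Finset.sum_mul]
  refine Finset.sum_congr rfl fun j hj => ?_
  rw [(Finset.mem_filter.1 hj).2]

/-- A bound `D` for the mixed `ℓ_ρ(ℓ_2)`-norm of `u` bounds a logarithmic mean of `u`, corrected by
entropies, with respect to any probability vector `q`. -/
theorem sum_log_le_log_of_mixed_norm_le [Fintype X] {u : J → ℝ} (hq : q ∈ stdSimplex ℝ J)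
    (hu : ∀ j, q j ≠ 0 → 0 < u j) {ρ D : ℝ} (hρ : 0 < ρ) (hD : 0 < D)
    (h : ∑ x, (∑ j with π j = x, u j ^ 2) ^ (ρ / 2) ≤ D ^ ρ) :
    ∑ j, q j * ((1 / 2 - ρ⁻¹) * Real.log (marginal π q (π j)) + Real.log (u j)
      - 1 / 2 * Real.log (q j)) ≤ Real.log D := by
  set w := marginal π q with hw
  set G : X → ℝ := fun x => ∑ j with π j = x, u j ^ 2 with hG
  have hG0 : ∀ x, 0 ≤ G x := fun x => Finset.sum_nonneg fun j _ => sq_nonneg _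
  have hws : w ∈ stdSimplex ℝ X := marginal_mem_stdSimplex hq
  have hDρ : 0 < D ^ ρ := Real.rpow_pos_of_pos hD ρ
  have hpt : ∀ j, q j * ((1 / 2 - ρ⁻¹) * Real.log (w (π j)) + Real.log (u j)
      - 1 / 2 * Real.log (q j) - Real.log D) ≤
      1 / 2 * (u j ^ 2 * (w (π j) / G (π j)) - q j)
        + ρ⁻¹ * (q j * ((w (π j))⁻¹ * (G (π j) ^ (ρ / 2) / D ^ ρ)) - q j) := by
    intro j
    have hwj : q j ≤ w (π j) := le_marginal hq.1 j
    rcases eq_or_ne (q j) 0 with h0 | h0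
    · rw [h0, zero_mul, zero_mul, sub_zero, sub_zero, mul_zero, add_zero]
      have := hG0 (π j)
      have := hws.1 (π j)
      positivity
    · have hqj : 0 < q j := lt_of_le_of_ne (hq.1 j) (Ne.symm h0)
      have huj := hu j h0
      have hwp : 0 < w (π j) := hqj.trans_le hwj
      have hGp : 0 < G (π j) := lt_of_lt_of_le (by positivity)
        (Finset.single_le_sum (f := fun j => u j ^ 2) (fun j _ => sq_nonneg _)
          (by simp : j ∈ Finset.univ.filter fun k => π k = π j))
      -- both terms come from `log y ≤ y - 1`
      have l1 := Real.log_le_sub_one_of_pos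
        (show 0 < u j ^ 2 * (w (π j) / G (π j)) / q j by positivity)
      have l2 := Real.log_le_sub_one_of_pos
        (show 0 < (w (π j))⁻¹ * (G (π j) ^ (ρ / 2) / D ^ ρ) by positivity)
      rw [Real.log_div (by positivity) h0, Real.log_mul (by positivity) (by positivity),
        Real.log_div hwp.ne' hGp.ne', Real.log_pow] at l1
      rw [Real.log_mul (by positivity) (by positivity), Real.log_inv,
        Real.log_div (by positivity) (by positivity), Real.log_rpow hGp, Real.log_rpow hD] at l2
      push_cast at l1
      have m1 := mul_le_mul_of_nonneg_left l1 hqj.le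
      have m2 := mul_le_mul_of_nonneg_left l2 hqj.le
      have e1 : q j * (u j ^ 2 * (w (π j) / G (π j)) / q j - 1)
          = u j ^ 2 * (w (π j) / G (π j)) - q j := by field_simp
      rw [e1] at m1
      have m3 := mul_le_mul_of_nonneg_left m2 (inv_pos.2 hρ).le
      have e2 : ρ⁻¹ * (q j * (-Real.log (w (π j))
            + (ρ / 2 * Real.log (G (π j)) - ρ * Real.log D)))
          = q j * (-ρ⁻¹ * Real.log (w (π j)) + (1 / 2 * Real.log (G (π j)) - Real.log D)) := by
        field_simp
      rw [e2] at m3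
      linarith
  have s1 : ∑ j, u j ^ 2 * (w (π j) / G (π j)) ≤ 1 := by
    rw [sum_mul_comp_eq_sum_marginal (q := fun j => u j ^ 2) (fun x => w x / G x), ← hws.2]
    refine Finset.sum_le_sum fun x _ => ?_
    change G x * (w x / G x) ≤ w x
    rcases eq_or_ne (G x) 0 with h0 | h0
    · rw [h0, zero_mul]; exact hws.1 x
    · rw [mul_div_cancel₀ _ h0]
  have s2 : ∑ j, q j * ((w (π j))⁻¹ * (G (π j) ^ (ρ / 2) / D ^ ρ)) ≤ 1 := by
    rw [sum_mul_comp_eq_sum_marginal (fun x => (w x)⁻¹ * (G x ^ (ρ / 2) / D ^ ρ))]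
    refine le_trans (b := ∑ x, G x ^ (ρ / 2) / D ^ ρ) (Finset.sum_le_sum fun x _ => ?_) ?_
    · rw [← hw, ← mul_assoc]
      have := hG0 x
      exact mul_le_of_le_one_left (by positivity) mul_inv_le_one
    · rwa [← Finset.sum_div, div_le_one hDρ]
  have htot := Finset.sum_le_sum fun j (_ : j ∈ Finset.univ) => hpt j
  simp only [Finset.sum_add_distrib, ← Finset.mul_sum, Finset.sum_sub_distrib, mul_sub,
    ← Finset.sum_mul] at htot
  rw [hq.2] at htot
  simp only [mul_add, mul_sub, Finset.sum_add_distrib, Finset.sum_sub_distrib] at htot ⊢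
  have hρ' := inv_pos.2 hρ
  nlinarith [mul_le_mul_of_nonneg_left s2 hρ'.le]

end Marginal

/-! ### Coefficient arrays of multilinear forms -/

section Arrays

variable {𝕜 : Type*} [RCLike 𝕜] {m n : ℕ}

/-- The `m`-linear form with coefficients `t` is bounded by `B` on the product of the unit balls of
`ℓ_{1/a₁}, …, ℓ_{1/aₘ}`. A vector `z` lies in the unit ball of `ℓ_{1/a}` when `|z| ≤ w ^ a` for a
probability vector `w`; since `0 ^ 0 = 1`, this covers `a = 0`, that is `ℓ_∞`, as well. -/
def FormBound (a : Fin m → ℝ) (t : (Fin m → Fin n) → 𝕜) (B : ℝ) : Prop :=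
  ∀ (w : Fin m → Fin n → ℝ) (z : Fin m → Fin n → 𝕜), (∀ i, w i ∈ stdSimplex ℝ (Fin n)) →
    (∀ i x, ‖z i x‖ ≤ w i x ^ a i) → ‖∑ j, t j * ∏ i, z i (j i)‖ ≤ B

/-- The array obtained by inserting the vector `z` in the `l`-th variable. -/
def contract (l : Fin (m + 1)) (z : Fin n → 𝕜) (t : (Fin (m + 1) → Fin n) → 𝕜) :
    (Fin m → Fin n) → 𝕜 :=
  fun j => ∑ y, z y * t (l.insertNth y j)

theorem sum_insertNth {M : Type*} [AddCommMonoid M] (l : Fin (m + 1))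
    (F : (Fin (m + 1) → Fin n) → M) :
    ∑ j, F j = ∑ j' : Fin m → Fin n, ∑ y, F (l.insertNth y j') := by
  rw [Finset.sum_comm, ← Fintype.sum_prod_type', ← (Fin.insertNthEquiv (fun _ => Fin n) l).sum_comp]
  rfl

theorem FormBound.contract {a : Fin (m + 1) → ℝ} {t : (Fin (m + 1) → Fin n) → 𝕜} {B : ℝ}
    (h : FormBound a t B) (l : Fin (m + 1)) {w : Fin n → ℝ} {z : Fin n → 𝕜}
    (hw : w ∈ stdSimplex ℝ (Fin n)) (hz : ∀ y, ‖z y‖ ≤ w y ^ a l) :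
    FormBound (fun i => a (l.succAbove i)) (contract l z t) B := by
  intro w' z' hw' hz'
  have := h (l.insertNth w w') (l.insertNth z z')
    (fun i => by
      rcases Fin.eq_self_or_eq_succAbove l i with rfl | ⟨i, rfl⟩
      · simpa using hw
      · simpa using hw' i)
    (fun i x => by
      rcases Fin.eq_self_or_eq_succAbove l i with rfl | ⟨i, rfl⟩
      · simpa using hz x
      · simpa using hz' i x)
  refine le_of_eq_of_le (congrArg norm ?_) this
  rw [sum_insertNth l]
  refine Finset.sum_congr rfl fun j' _ => ?_
  rw [_root_.contract, Finset.sum_mul]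
  refine Finset.sum_congr rfl fun y _ => ?_
  rw [Fin.prod_univ_succAbove _ l]
  simp only [Fin.insertNth_apply_same, Fin.insertNth_apply_succAbove]
  ring

theorem norm_signed_le {w e : Fin n → ℝ} {a : ℝ} (hw : w ∈ stdSimplex ℝ (Fin n))
    (he : ∀ i, |e i| = 1) (y : Fin n) : ‖((e y * w y ^ a : ℝ) : 𝕜)‖ ≤ w y ^ a := by
  rw [RCLike.norm_ofReal, abs_mul, he, one_mul, abs_of_nonneg (Real.rpow_nonneg (hw.1 y) a)]

/-- If all signed contractions of an array in the variable `l` satisfy a mixed norm estimate, then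
Khinchine's inequality moves the variable `l` into the inner `ℓ_2`-norm. -/
theorem mixed_norm_le_of_contract (t : (Fin (m + 1) → Fin n) → 𝕜) (l : Fin (m + 1)) (i : Fin m)
    (c : Fin n → ℝ) {ρ γ D : ℝ} (hρ₁ : 1 ≤ ρ) (hρ₂ : ρ ≤ 2) (hD : 0 ≤ D)
    (hγ : min (1 / 2) (8 / 5 * (ρ⁻¹ - 1 / 2)) ≤ γ)
    (h : ∀ e : Fin n → ℝ, (∀ y, |e y| = 1) →
      ∑ x, (∑ j with j i = x, ‖contract l (fun y => ((e y * c y : ℝ) : 𝕜)) t j‖ ^ 2) ^ (ρ / 2)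
        ≤ D ^ ρ) :
    ∑ x, (∑ j with j (l.succAbove i) = x, (‖t j‖ * c (j l)) ^ 2) ^ (ρ / 2) ≤ (2 ^ γ * D) ^ ρ := by
  let V : Fin n → Fin n → EuclideanSpace 𝕜 (Fin m → Fin n) := fun x y =>
    WithLp.toLp 2 fun j => if j i = x then (c y : 𝕜) * t (l.insertNth y j) else 0
  have hV1 : ∀ (e : Fin n → ℝ) x, ‖∑ y, ((e y : ℝ) : 𝕜) • V x y‖ ^ ρ
      = (∑ j with j i = x, ‖contract l (fun y => ((e y * c y : ℝ) : 𝕜)) t j‖ ^ 2) ^ (ρ / 2) := by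
    intro e x
    have : ‖∑ y, ((e y : ℝ) : 𝕜) • V x y‖ ^ 2
        = ∑ j with j i = x, ‖contract l (fun y => ((e y * c y : ℝ) : 𝕜)) t j‖ ^ 2 := by
      rw [EuclideanSpace.norm_sq_eq, Finset.sum_filter]
      refine Finset.sum_congr rfl fun j _ => ?_
      simp only [V, WithLp.ofLp_sum, WithLp.ofLp_smul, Finset.sum_apply, Pi.smul_apply]
      split_ifs with hj
      · congr 2
        refine Finset.sum_congr rfl fun y _ => ?_
        simp only [smul_eq_mul, RCLike.ofReal_mul, mul_assoc]
      · simp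
    rw [← this, ← Real.rpow_natCast, ← Real.rpow_mul (norm_nonneg _)]
    congr 1
    push_cast
    ring
  have hV2 : ∀ x, ∑ y, ‖V x y‖ ^ 2
      = ∑ j with j (l.succAbove i) = x, (‖t j‖ * c (j l)) ^ 2 := by
    intro x
    rw [Finset.sum_filter, sum_insertNth l, Finset.sum_comm]
    refine Finset.sum_congr rfl fun y _ => ?_
    rw [EuclideanSpace.norm_sq_eq]
    refine Finset.sum_congr rfl fun j _ => ?_
    simp only [V, Fin.insertNth_apply_same, Fin.insertNth_apply_succAbove]
    split_ifs
    · rw [norm_mul, RCLike.norm_ofReal, mul_pow, sq_abs, mul_pow, mul_comm]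
    · simp
  have h2 : (0 : ℝ) ≤ 2 ^ γ := by positivity
  calc _ ≤ ∑ x, ((2 : ℝ) ^ γ) ^ ρ * signAvg (fun e => ‖∑ y, ((e y : ℝ) : 𝕜) • V x y‖ ^ ρ) := by
        refine Finset.sum_le_sum fun x _ => ?_
        rw [← hV2]
        exact khinchine (V x) hρ₁ hρ₂ hγ
    _ = ((2 : ℝ) ^ γ) ^ ρ * signAvg (fun e => ∑ x, ‖∑ y, ((e y : ℝ) : 𝕜) • V x y‖ ^ ρ) := by
        rw [signAvg_sum, Finset.mul_sum]
    _ ≤ ((2 : ℝ) ^ γ) ^ ρ * signAvg (fun _ : Fin n → ℝ => D ^ ρ) := by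
        refine mul_le_mul_of_nonneg_left (signAvg_mono fun e he => ?_) (by positivity)
        simp only [hV1]
        exact h e he
    _ = _ := by rw [signAvg_const, Real.mul_rpow h2 hD]

end Arrays

/-! ### Mixed norm estimates -/

section Mixed

variable {𝕜 : Type*} [RCLike 𝕜] {m n : ℕ}

/-- Minus the Shannon entropy of the `i`-th marginal of `q`. -/
noncomputable def coordLog (q : (Fin m → Fin n) → ℝ) (i : Fin m) : ℝ :=
  ∑ j, q j * Real.log (marginal (fun j => j i) q (j i))

theorem sum_mul_log_le_coordLog {q : (Fin m → Fin n) → ℝ} (hq : ∀ j, 0 ≤ q j) (i : Fin m) :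
    ∑ j, q j * Real.log (q j) ≤ coordLog q i := by
  refine Finset.sum_le_sum fun j _ => ?_
  rcases (hq j).eq_or_lt with h | h
  · simp [← h]
  · exact mul_le_mul_of_nonneg_left
      (Real.log_le_log h (le_marginal (π := fun j => j i) hq j)) h.le

/-- Every `m`-linear form bounded by `B` on `ℓ_{1/a₁} × ⋯ × ℓ_{1/aₘ}` has all its mixed
`ℓ_σ(ℓ_2)`-norms bounded by `2 ^ γ B`, where `1 / σ = 1 - ∑ a` and any single variable is the
outer one. -/
def MixedBound (𝕜 : Type*) [RCLike 𝕜] (n : ℕ) (a : Fin m → ℝ) (γ : ℝ) : Prop :=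
  ∀ (t : (Fin m → Fin n) → 𝕜) (B : ℝ), 0 < B → FormBound a t B → ∀ k,
    ∑ x, (∑ j with j k = x, ‖t j‖ ^ 2) ^ ((1 - ∑ i, a i)⁻¹ / 2)
      ≤ (2 ^ γ * B) ^ (1 - ∑ i, a i)⁻¹

/-- Every `m`-linear form bounded by `B` on `ℓ_{1/a₁} × ⋯ × ℓ_{1/aₘ}` has the `ℓ_λ`-norm of its
coefficients bounded by `2 ^ γ B`, where `1 / λ = 1 - ∑ a`. -/
def CoeffBound (𝕜 : Type*) [RCLike 𝕜] (n : ℕ) (a : Fin m → ℝ) (γ : ℝ) : Prop :=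
  ∀ (t : (Fin m → Fin n) → 𝕜) (B : ℝ), 0 < B → FormBound a t B →
    (∑ j, ‖t j‖ ^ (1 / (1 - ∑ i, a i))) ^ (1 - ∑ i, a i) ≤ 2 ^ γ * B

/-- The entropy form of the estimate for `m + 1` variables that follows from a mixed norm estimate
for the variables other than `l`: the vectors inserted in the variable `l` have random signs, and
their moduli are given by the `l`-th marginal of `q`. -/
theorem entropy_inequality {a : Fin (m + 1) → ℝ} (ha : ∀ i, 0 ≤ a i) {l i : Fin (m + 1)}
    (hil : i ≠ l) {γ δ : ℝ} (hmix : MixedBound 𝕜 n (fun i => a (l.succAbove i)) γ)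
    (hl : ∑ i, a i - a l ≤ 1 / 2) (hδ : min (1 / 2) (8 / 5 * (1 / 2 - (∑ i, a i - a l))) ≤ δ)
    {t : (Fin (m + 1) → Fin n) → 𝕜} {B : ℝ} (hB : 0 < B) (ht : FormBound a t B)
    {q : (Fin (m + 1) → Fin n) → ℝ} (hq : q ∈ stdSimplex ℝ (Fin (m + 1) → Fin n))
    (hqt : ∀ j, q j ≠ 0 → t j ≠ 0) :
    (∑ i, a i - a l - 1 / 2) * coordLog q i + a l * coordLog q l
      - 1 / 2 * ∑ j, q j * Real.log (q j) + ∑ j, q j * Real.log ‖t j‖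
      ≤ (γ + δ) * Real.log 2 + Real.log B := by
  obtain ⟨i, rfl⟩ := Fin.exists_succAbove_eq hil
  have hA : ∑ i, a (l.succAbove i) = ∑ i, a i - a l := by
    rw [Fin.sum_univ_succAbove a l]; ring
  set A := ∑ i, a i - a l with hAdef
  have hA0 : 0 ≤ A := hA ▸ Finset.sum_nonneg fun i _ => ha _
  set w := marginal (fun j : Fin (m + 1) → Fin n => j l) q with hw
  have hws : w ∈ stdSimplex ℝ (Fin n) := marginal_mem_stdSimplex hq
  have h1A : 0 < 1 - A := by linarith
  have key := mixed_norm_le_of_contract t l i (fun y => w y ^ a l) (ρ := (1 - A)⁻¹) (γ := δ)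
    (D := 2 ^ γ * B) ((one_le_inv₀ h1A).2 (by linarith))
    (by rw [inv_le_comm₀ h1A two_pos]; linarith) (by positivity)
    (by rw [inv_inv]; convert hδ using 3; ring)
    (fun e he => by
      have := hmix _ B hB (ht.contract l hws (norm_signed_le (𝕜 := 𝕜) hws he)) i
      rwa [hA] at this)
  have hpos : ∀ j, q j ≠ 0 → 0 < ‖t j‖ ∧ 0 < w (j l) := fun j hj =>
    ⟨norm_pos_iff.2 (hqt j hj), (lt_of_le_of_ne (hq.1 j) hj.symm).trans_le
      (le_marginal (π := fun j : Fin (m + 1) → Fin n => j l) hq.1 j)⟩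
  have := sum_log_le_log_of_mixed_norm_le (π := fun j => j (l.succAbove i))
    (u := fun j => ‖t j‖ * w (j l) ^ a l) hq
    (fun j hj => mul_pos (hpos j hj).1 (Real.rpow_pos_of_pos (hpos j hj).2 _))
    (inv_pos.2 h1A) (by positivity) key
  rw [inv_inv, Real.log_mul (by positivity) (by positivity),
    Real.log_mul (by positivity) (by positivity), Real.log_rpow two_pos,
    Real.log_rpow two_pos] at this
  have e : ∀ j, q j * ((1 / 2 - (1 - A)) * Real.log (marginal (fun j => j (l.succAbove i)) q
      (j (l.succAbove i))) + Real.log (‖t j‖ * w (j l) ^ a l) - 1 / 2 * Real.log (q j))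
      = (A - 1 / 2) * (q j * Real.log (marginal (fun j => j (l.succAbove i)) q
        (j (l.succAbove i)))) + a l * (q j * Real.log (w (j l))) - 1 / 2 * (q j * Real.log (q j))
        + q j * Real.log ‖t j‖ := by
    intro j
    by_cases hj : q j = 0
    · simp [hj]
    · obtain ⟨h1, h2⟩ := hpos j hj
      rw [Real.log_mul h1.ne' (Real.rpow_pos_of_pos h2 _).ne', Real.log_rpow h2]
      ring
  rw [Finset.sum_congr rfl fun j _ => e j] at this
  simp only [Finset.sum_add_distrib, Finset.sum_sub_distrib, ← Finset.mul_sum] at this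
  unfold coordLog
  linarith

/-- Induction step for mixed norms. The index `i` is the one whose marginal has the largest
entropy. -/
theorem MixedBound.step {a : Fin (m + 1) → ℝ} (ha : ∀ i, 0 ≤ a i) (hA : ∑ i, a i ≤ 1 / 2) {γ : ℝ}
    (h : ∀ i, ∃ l γ' δ, i ≠ l ∧ MixedBound 𝕜 n (fun i => a (l.succAbove i)) γ' ∧
      min (1 / 2) (8 / 5 * (1 / 2 - (∑ i, a i - a l))) ≤ δ ∧ γ' + δ ≤ γ) :
    MixedBound 𝕜 n a γ := by
  intro t B hB ht k
  set A := ∑ i, a i with hAdef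
  have h1A : 0 < 1 - A := by linarith
  set σ := (1 - A)⁻¹ with hσ
  have hσ0 : 0 < σ := inv_pos.2 h1A
  have hσA : (1 - A) * σ = 1 := mul_inv_cancel₀ h1A.ne'
  set G : Fin n → ℝ := fun x => ∑ j with j k = x, ‖t j‖ ^ 2 with hG
  have hG0 : ∀ x, 0 ≤ G x := fun x => Finset.sum_nonneg fun j _ => sq_nonneg _
  have hN0 : 0 ≤ ∑ x, G x ^ (σ / 2) := Finset.sum_nonneg fun x _ => Real.rpow_nonneg (hG0 x) _
  change ∑ x, G x ^ (σ / 2) ≤ _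
  set N := ∑ x, G x ^ (σ / 2) with hN
  rcases hN0.eq_or_lt with h0 | hNpos
  · rw [← h0]; positivity
  -- the probability vector that turns the variational inequality into an equality
  set q : (Fin (m + 1) → Fin n) → ℝ := fun j => G (j k) ^ (σ / 2 - 1) * ‖t j‖ ^ 2 / N with hq
  have hmarg : ∀ x, marginal (fun j => j k) q x = G x ^ (σ / 2) / N := by
    intro x
    have : marginal (fun j => j k) q x = G x ^ (σ / 2 - 1) * G x / N := by
      rw [marginal, hG, Finset.mul_sum, Finset.sum_div]
      refine Finset.sum_congr rfl fun j hj => ?_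
      rw [hq, ← (Finset.mem_filter.1 hj).2]
    rw [this]
    rcases (hG0 x).eq_or_lt with hx | hx
    · rw [← hx, mul_zero, Real.zero_rpow (by positivity)]
    · rw [Real.rpow_sub_one hx.ne', div_mul_cancel₀ _ hx.ne']
  have hqs : q ∈ stdSimplex ℝ (Fin (m + 1) → Fin n) := by
    refine ⟨fun j => by have := hG0 (j k); positivity, ?_⟩
    rw [← Finset.sum_fiberwise Finset.univ (fun j => j k)]
    change ∑ x, marginal (fun j => j k) q x = 1
    simp only [hmarg]
    rw [← Finset.sum_div, ← hN, div_self hNpos.ne']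
  have hqt : ∀ j, q j ≠ 0 → t j ≠ 0 := by
    intro j hj h0
    exact hj (by simp [hq, h0])
  have hlog : ∑ j, q j * Real.log ‖t j‖ = 1 / 2 * ∑ j, q j * Real.log (q j)
      + (1 - A) * Real.log N + (1 / 2 - A) * coordLog q k := by
    have : ∀ j, q j * Real.log ‖t j‖ = 1 / 2 * (q j * Real.log (q j))
        + q j * ((1 - A) * Real.log N)
        + (1 / 2 - A) * (q j * Real.log (marginal (fun j => j k) q (j k))) := by
      intro j
      by_cases hj : q j = 0
      · simp [hj]
      have htj : 0 < ‖t j‖ := norm_pos_iff.2 (hqt j hj)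
      have hGj : 0 < G (j k) := lt_of_lt_of_le (by positivity)
        (Finset.single_le_sum (f := fun j => ‖t j‖ ^ 2) (fun j _ => sq_nonneg _)
          (by simp : j ∈ Finset.univ.filter fun i => i k = j k))
      have l1 : Real.log (q j) = (σ / 2 - 1) * Real.log (G (j k)) + 2 * Real.log ‖t j‖
          - Real.log N := by
        rw [hq]
        simp only
        rw [Real.log_div (by positivity) hNpos.ne', Real.log_mul (by positivity) (by positivity),
          Real.log_rpow hGj, Real.log_pow]
        norm_num
      have l2 : Real.log (marginal (fun j => j k) q (j k))
          = σ / 2 * Real.log (G (j k)) - Real.log N := by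
        rw [hmarg, Real.log_div (by positivity) hNpos.ne', Real.log_rpow hGj]
      rw [l1, l2]
      linear_combination (-(1 / 2) * q j * Real.log (G (j k))) * hσA
    rw [Finset.sum_congr rfl fun j _ => this j]
    simp only [Finset.sum_add_distrib, ← Finset.mul_sum, ← Finset.sum_mul]
    rw [hqs.2]
    unfold coordLog
    ring
  obtain ⟨i, -, hi⟩ := Finset.exists_min_image Finset.univ (coordLog q) ⟨k, Finset.mem_univ k⟩
  obtain ⟨l, γ', δ, hil, hmix, hδ, hγ⟩ := h i
  have hal := ha l
  have key := entropy_inequality ha hil hmix (by linarith) hδ hB ht hqs hqt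
  rw [hlog] at key
  have k1 := mul_nonneg (show 0 ≤ 1 / 2 - A by linarith) (sub_nonneg.2 (hi k (Finset.mem_univ k)))
  have k2 := mul_nonneg hal (sub_nonneg.2 (hi l (Finset.mem_univ l)))
  have k3 := mul_le_mul_of_nonneg_right hγ (Real.log_nonneg one_le_two)
  have k4 : (1 - A) * Real.log N ≤ γ * Real.log 2 + Real.log B := by
    rw [← hAdef] at key
    linarith
  rw [← Real.log_le_log_iff hNpos (by positivity), Real.log_rpow (by positivity),
    Real.log_mul (by positivity) (by positivity), Real.log_rpow two_pos]
  calc Real.log N = σ * ((1 - A) * Real.log N) := by rw [← mul_assoc, mul_comm σ, hσA, one_mul]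
    _ ≤ _ := by gcongr

/-- For linear forms the estimate is the duality of `ℓ_p` and `ℓ_{p'}`. -/
theorem sum_rpow_le_of_formBound_one {a : Fin 1 → ℝ} (ha : 0 ≤ a 0) (ha₁ : a 0 < 1)
    {t : (Fin 1 → Fin n) → 𝕜} {B : ℝ} (hB : 0 < B) (ht : FormBound a t B) :
    ∑ x, ‖t fun _ => x‖ ^ (1 - a 0)⁻¹ ≤ B ^ (1 - a 0)⁻¹ := by
  have h1A : 0 < 1 - a 0 := by linarith
  set σ := (1 - a 0)⁻¹ with hσ
  have hσ0 : 0 < σ := inv_pos.2 h1A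
  have hN0 : 0 ≤ ∑ x, ‖t fun _ => x‖ ^ σ :=
    Finset.sum_nonneg fun x _ => Real.rpow_nonneg (norm_nonneg _) _
  set N := ∑ x, ‖t fun _ => x‖ ^ σ with hN
  rcases hN0.eq_or_lt with h0 | hNpos
  · rw [← h0]; positivity
  set w : Fin n → ℝ := fun x => ‖t fun _ => x‖ ^ σ / N with hw
  have hws : w ∈ stdSimplex ℝ (Fin n) := by
    refine ⟨fun x => by positivity, ?_⟩
    rw [hw, ← Finset.sum_div, ← hN, div_self hNpos.ne']
  set z : Fin n → 𝕜 := fun x => ((w x ^ a 0 / ‖t fun _ => x‖ : ℝ) : 𝕜)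
    * (starRingEnd 𝕜) (t fun _ => x) with hz
  have hbd := ht (fun _ => w) (fun _ => z) (fun _ => hws) (by
    intro i x
    have := hws.1 x
    rw [Subsingleton.elim i 0, hz]
    simp only
    rw [norm_mul, RCLike.norm_ofReal, RCLike.norm_conj, abs_of_nonneg (by positivity)]
    by_cases h : ‖t fun _ => x‖ = 0
    · rw [h, mul_zero]; positivity
    · rw [div_mul_cancel₀ _ h])
  have hterm : ∀ x, (t fun _ => x) * z x = ((N ^ (1 - a 0) * w x : ℝ) : 𝕜) := by
    intro x
    have hwx := hws.1 x
    have h1 : (t fun _ => x) * z x = ((w x ^ a 0 * ‖t fun _ => x‖ : ℝ) : 𝕜) := by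
      rw [hz]
      simp only
      rw [mul_left_comm, RCLike.mul_conj]
      rw [← RCLike.ofReal_pow, ← RCLike.ofReal_mul]
      congr 1
      by_cases h : ‖t fun _ => x‖ = 0
      · simp [h]
      · field_simp
    have h2 : ‖t fun _ => x‖ = N ^ (1 - a 0) * w x ^ (1 - a 0) := by
      rw [← Real.mul_rpow hN0 hwx, hw]
      simp only
      rw [mul_div_cancel₀ _ hNpos.ne', ← Real.rpow_mul (norm_nonneg _), hσ,
        inv_mul_cancel₀ h1A.ne', Real.rpow_one]
    rw [h1, h2, mul_left_comm, ← Real.rpow_add_of_nonneg hwx ha h1A.le]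
    simp
  rw [← (Equiv.funUnique (Fin 1) (Fin n)).symm.sum_comp] at hbd
  have e : ∀ x : Fin n, (Equiv.funUnique (Fin 1) (Fin n)).symm x = fun _ => x := fun x => rfl
  simp only [e, Fin.prod_univ_one, hterm] at hbd
  rw [← RCLike.ofReal_sum, ← Finset.mul_sum, hws.2, mul_one, RCLike.norm_ofReal,
    abs_of_nonneg (by positivity)] at hbd
  calc N = (N ^ (1 - a 0)) ^ σ := by
        rw [← Real.rpow_mul hN0, hσ, mul_inv_cancel₀ h1A.ne', Real.rpow_one]
    _ ≤ B ^ σ := by gcongr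

theorem mixedBound_one {a : Fin 1 → ℝ} (ha : 0 ≤ a 0) (ha₁ : a 0 < 1) : MixedBound 𝕜 n a 0 := by
  intro t B hB ht k
  have h := sum_rpow_le_of_formBound_one ha ha₁ hB ht
  rw [Subsingleton.elim k 0, Fin.sum_univ_one, Real.rpow_zero, one_mul]
  refine le_of_eq_of_le (Finset.sum_congr rfl fun x _ => ?_) h
  rw [Finset.sum_eq_single_of_mem (fun _ => x) (by simp), ← Real.rpow_natCast,
    ← Real.rpow_mul (norm_nonneg _)]
  · congr 1; push_cast; ring
  · intro j hj hne
    exact absurd (funext fun i => by rw [Subsingleton.elim i 0]; exact (Finset.mem_filter.1 hj).2)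
      hne

theorem exists_ne_mul_le_sum_sub {a : Fin (m + 2) → ℝ} {μ : ℝ} (hμ : ∀ i, μ ≤ a i)
    (i : Fin (m + 2)) : ∃ l, i ≠ l ∧ (m + 1 : ℝ) * a l ≤ ∑ i, a i - μ := by
  obtain ⟨l, hl, hmin⟩ := Finset.exists_min_image (Finset.univ.erase i) a
    (by rw [← Finset.card_pos, Finset.card_erase_of_mem (Finset.mem_univ i)]; simp)
  refine ⟨l, (Finset.ne_of_mem_erase hl).symm, ?_⟩
  have h1 := Finset.card_nsmul_le_sum _ _ _ hmin
  rw [Finset.card_erase_of_mem (Finset.mem_univ i), Finset.card_univ, Fintype.card_fin,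
    nsmul_eq_mul] at h1
  have h2 := Finset.add_sum_erase Finset.univ a (Finset.mem_univ i)
  have h3 := hμ i
  push_cast [Nat.add_sub_cancel, show m + 2 - 1 = m + 1 from rfl] at h1
  linarith

/-- At each step the variable with the smallest exponent, among those that may be removed, is
removed. Only the step from one variable to two uses the constant `√2`; in the others the constant
of Khinchine's inequality decays as the exponent approaches `2`. -/
theorem mixedBound_add_two {m : ℕ} : ∀ {a : Fin (m + 2) → ℝ} {μ : ℝ}, 0 ≤ μ → (∀ i, μ ≤ a i) →
    ∑ i, a i ≤ 1 / 2 → MixedBound 𝕜 n a (1 / 2 + m * (1 - μ - ∑ i, a i)) := by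
  induction m with
  | zero =>
    intro a μ hμ₀ hμ hA
    refine MixedBound.step (fun i => hμ₀.trans (hμ i)) hA fun i => ?_
    obtain ⟨l, hil⟩ := exists_ne i
    have hl : a (l.succAbove 0) ≤ 1 / 2 := (Finset.single_le_sum
      (fun i _ => hμ₀.trans (hμ i)) (Finset.mem_univ _)).trans hA
    exact ⟨l, 0, 1 / 2, hil.symm, mixedBound_one (hμ₀.trans (hμ _)) (by linarith),
      min_le_left _ _, by simp⟩
  | succ m ih =>
    intro a μ hμ₀ hμ hA
    refine MixedBound.step (fun i => hμ₀.trans (hμ i)) hA fun i => ?_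
    obtain ⟨l, hil, hl⟩ := exists_ne_mul_le_sum_sub hμ i
    have hs : ∑ i, a (l.succAbove i) = ∑ i, a i - a l := by
      rw [Fin.sum_univ_succAbove a l]; ring
    have hal := hμ₀.trans (hμ l)
    refine ⟨l, _, 2 * (1 / 2 - (∑ i, a i - a l)), hil,
      ih hμ₀ (fun i => hμ _) (by rw [hs]; linarith), ?_, ?_⟩
    · exact (min_le_right _ _).trans (by linarith)
    · rw [hs]
      push_cast at hl ⊢
      nlinarith

end Mixed

/-! ### Estimates for the sum of all coefficients -/

section Coefficients

variable {𝕜 : Type*} [RCLike 𝕜] {m n : ℕ}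

theorem sum_rpow_le_rpow_sum {ι : Type*} (s : Finset ι) {x : ι → ℝ} (hx : ∀ i, 0 ≤ x i) {p : ℝ}
    (hp : 1 ≤ p) : ∑ i ∈ s, x i ^ p ≤ (∑ i ∈ s, x i) ^ p := by
  have hX : 0 ≤ ∑ i ∈ s, x i := Finset.sum_nonneg fun i _ => hx i
  have e : ∀ {y : ℝ}, 0 ≤ y → y ^ p = y * y ^ (p - 1) := fun hy => by
    rw [← Real.rpow_one_add' hy (by linarith), add_sub_cancel]
  rw [e hX, Finset.sum_mul]
  refine Finset.sum_le_sum fun i hi => ?_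
  rw [e (hx i)]
  have h1 := hx i
  gcongr
  exact Finset.single_le_sum (fun i _ => hx i) hi

/-- The probability vector proportional to the powers `‖t‖ ^ λ` of the coefficients, where
`λ = 1 / c`. -/
noncomputable def coeffDist (t : (Fin m → Fin n) → 𝕜) (c : ℝ) (j : Fin m → Fin n) : ℝ :=
  ‖t j‖ ^ (1 / c) / ∑ i, ‖t i‖ ^ (1 / c)

theorem coeffDist_mem_stdSimplex {t : (Fin m → Fin n) → 𝕜} {c : ℝ}
    (hM : 0 < ∑ i, ‖t i‖ ^ (1 / c)) : coeffDist t c ∈ stdSimplex ℝ (Fin m → Fin n) := by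
  refine ⟨fun j => by unfold coeffDist; positivity, ?_⟩
  unfold coeffDist
  rw [← Finset.sum_div, div_self hM.ne']

theorem norm_eq_mul_coeffDist {t : (Fin m → Fin n) → 𝕜} {c : ℝ} (hc : 0 < c)
    (hM : 0 < ∑ i, ‖t i‖ ^ (1 / c)) (j : Fin m → Fin n) :
    ‖t j‖ = ((∑ i, ‖t i‖ ^ (1 / c)) * coeffDist t c j) ^ c := by
  unfold coeffDist
  rw [mul_div_cancel₀ _ hM.ne', ← Real.rpow_mul (norm_nonneg _), one_div,
    inv_mul_cancel₀ hc.ne', Real.rpow_one]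

/-- A variable that is not needed for the exponent to reach `2` costs nothing: the `ℓ_{λ'}`-norm
dominates the `ℓ_2`-mean over signs, because `λ' ≥ 2`. -/
theorem CoeffBound.add_variable {a : Fin (m + 1) → ℝ} (l : Fin (m + 1)) (hal : 0 ≤ a l)
    (hA : ∑ i, a i < 1) (hA' : 1 / 2 ≤ ∑ i, a (l.succAbove i)) {γ : ℝ}
    (h : CoeffBound 𝕜 n (fun i => a (l.succAbove i)) γ) : CoeffBound 𝕜 n a γ := by
  intro t B hB ht
  have hs : ∑ i, a i = a l + ∑ i, a (l.succAbove i) := Fin.sum_univ_succAbove a l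
  set c := 1 - ∑ i, a i with hc
  set c' := 1 - ∑ i, a (l.succAbove i) with hc'
  have hc0 : 0 < c := by linarith
  have hcc : c' = a l + c := by linarith
  have hc'0 : 0 < c' := by linarith
  have hM0 : 0 ≤ ∑ i, ‖t i‖ ^ (1 / c) :=
    Finset.sum_nonneg fun x _ => Real.rpow_nonneg (norm_nonneg _) _
  rcases hM0.eq_or_lt with h0 | hM
  · rw [← h0, Real.zero_rpow hc0.ne']; positivity
  have hqs := coeffDist_mem_stdSimplex hM
  have hqn := norm_eq_mul_coeffDist hc0 hM
  set M := ∑ i, ‖t i‖ ^ (1 / c) with hMdef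
  set q := coeffDist t c
  set w := marginal (fun j : Fin (m + 1) → Fin n => j l) q with hw
  have hws : w ∈ stdSimplex ℝ (Fin n) := marginal_mem_stdSimplex hqs
  have hD : 0 < (2 : ℝ) ^ γ * B := by positivity
  set D := (2 : ℝ) ^ γ * B
  have hr : 1 ≤ 1 / c' / 2 := by
    rw [div_div, le_div_iff₀ (by positivity)]; linarith
  have hcon : ∀ e : Fin n → ℝ, (∀ y, |e y| = 1) →
      ∑ j, ‖contract l (fun y => ((e y * w y ^ a l : ℝ) : 𝕜)) t j‖ ^ (1 / c') ≤ D ^ (1 / c') := by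
    intro e he
    have := h _ B hB (ht.contract l hws (norm_signed_le (𝕜 := 𝕜) hws he))
    have h1 : 0 ≤ ∑ j, ‖contract l (fun y => ((e y * w y ^ a l : ℝ) : 𝕜)) t j‖ ^ (1 / c') :=
      Finset.sum_nonneg fun x _ => Real.rpow_nonneg (norm_nonneg _) _
    have h2 := Real.rpow_le_rpow (by positivity) this (z := 1 / c') (by positivity)
    rwa [← Real.rpow_mul h1, mul_one_div_cancel hc'0.ne', Real.rpow_one] at h2
  have hlow : ∀ j' : Fin m → Fin n,
      ∑ y, M ^ (c / c') * q (l.insertNth y j') ≤ signAvg fun e =>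
        ‖contract l (fun y => ((e y * w y ^ a l : ℝ) : 𝕜)) t j'‖ ^ (1 / c') := by
    intro j'
    set v : Fin n → 𝕜 := fun y => ((w y ^ a l : ℝ) : 𝕜) * t (l.insertNth y j') with hv
    have hve : ∀ e : Fin n → ℝ, contract l (fun y => ((e y * w y ^ a l : ℝ) : 𝕜)) t j'
        = ∑ y, ((e y : ℝ) : 𝕜) • v y := by
      intro e
      refine Finset.sum_congr rfl fun y _ => ?_
      simp only [hv, smul_eq_mul, RCLike.ofReal_mul, mul_assoc]
    simp only [hve]
    calc ∑ y, M ^ (c / c') * q (l.insertNth y j') ≤ ∑ y, (‖v y‖ ^ 2) ^ (1 / c' / 2) := by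
          refine Finset.sum_le_sum fun y _ => ?_
          have hq0 := hqs.1 (l.insertNth y j')
          have hqw : q (l.insertNth y j') ≤ w y := by
            have := le_marginal (π := fun j : Fin (m + 1) → Fin n => j l) hqs.1 (l.insertNth y j')
            simpa using this
          -- the marginal `w` dominates `q` pointwise, so the weights restore the power of `q`
          have hvy : M ^ c * q (l.insertNth y j') ^ c' ≤ ‖v y‖ := by
            rw [hv]
            simp only
            rw [norm_mul, RCLike.norm_ofReal, abs_of_nonneg (Real.rpow_nonneg (hws.1 y) _), hqn,
              Real.mul_rpow hM0 hq0, hcc, Real.rpow_add_of_nonneg hq0 hal hc0.le]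
            calc _ = q (l.insertNth y j') ^ a l * (M ^ c * q (l.insertNth y j') ^ c) := by ring
              _ ≤ _ := by gcongr
          calc _ = (M ^ c * q (l.insertNth y j') ^ c') ^ (1 / c') := by
                rw [Real.mul_rpow (by positivity) (by positivity), ← Real.rpow_mul hM0,
                  ← Real.rpow_mul hq0, mul_one_div_cancel hc'0.ne', Real.rpow_one, mul_one_div]
            _ ≤ ‖v y‖ ^ (1 / c') := by gcongr
            _ = _ := by
                rw [← Real.rpow_natCast, ← Real.rpow_mul (norm_nonneg _)]
                congr 1; push_cast; ring
      _ ≤ (∑ y, ‖v y‖ ^ 2) ^ (1 / c' / 2) := sum_rpow_le_rpow_sum _ (fun y => sq_nonneg _) hr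
      _ = (signAvg fun e => ‖∑ y, ((e y : ℝ) : 𝕜) • v y‖ ^ 2) ^ (1 / c' / 2) := by
          rw [signAvg_norm_sq]
      _ ≤ signAvg fun e => (‖∑ y, ((e y : ℝ) : 𝕜) • v y‖ ^ 2) ^ (1 / c' / 2) :=
          rpow_signAvg_le (fun e => sq_nonneg _) hr
      _ = _ := by
          congr 1; funext e
          rw [← Real.rpow_natCast, ← Real.rpow_mul (norm_nonneg _)]
          congr 1; push_cast; ring
  have hfin : M ^ (c / c') ≤ D ^ (1 / c') := by
    calc M ^ (c / c') = ∑ j' : Fin m → Fin n, ∑ y, M ^ (c / c') * q (l.insertNth y j') := by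
          rw [← sum_insertNth l fun j => M ^ (c / c') * q j, ← Finset.mul_sum, hqs.2, mul_one]
      _ ≤ ∑ j', signAvg fun e =>
          ‖contract l (fun y => ((e y * w y ^ a l : ℝ) : 𝕜)) t j'‖ ^ (1 / c') :=
          Finset.sum_le_sum fun j' _ => hlow j'
      _ = signAvg fun e => ∑ j',
          ‖contract l (fun y => ((e y * w y ^ a l : ℝ) : 𝕜)) t j'‖ ^ (1 / c') :=
          (signAvg_sum _ _).symm
      _ ≤ signAvg fun _ : Fin n → ℝ => D ^ (1 / c') := signAvg_mono hcon
      _ = D ^ (1 / c') := signAvg_const _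
  rw [div_eq_mul_one_div, Real.rpow_mul hM0] at hfin
  exact (Real.rpow_le_rpow_iff (by positivity) hD.le (by positivity)).1 hfin

theorem coeffBound_one {a : Fin 1 → ℝ} (ha : 0 ≤ a 0) (ha₁ : a 0 < 1) : CoeffBound 𝕜 n a 0 := by
  intro t B hB ht
  have h := sum_rpow_le_of_formBound_one ha ha₁ hB ht
  have h1A : 0 < 1 - a 0 := by linarith
  rw [Fin.sum_univ_one, Real.rpow_zero, one_mul, one_div,
    ← (Equiv.funUnique (Fin 1) (Fin n)).symm.sum_comp]
  change (∑ x, ‖t fun _ => x‖ ^ (1 - a 0)⁻¹) ^ _ ≤ _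
  refine (Real.rpow_le_rpow (Finset.sum_nonneg fun x _ => Real.rpow_nonneg (norm_nonneg _) _) h
    h1A.le).trans_eq ?_
  rw [← Real.rpow_mul hB.le, inv_mul_cancel₀ h1A.ne', Real.rpow_one]

/-- To bound the coefficients it suffices to prove an inequality between the logarithms of their
norm and of `B`, given an entropy inequality for every pair of variables. -/
theorem coeffBound_of_entropy {a : Fin (m + 1) → ℝ} (ha : ∀ i, 0 ≤ a i) (hA : ∑ i, a i < 1) {γ : ℝ}
    (h : ∀ (b L H : ℝ) (h : Fin (m + 1) → ℝ), (∀ i, H ≤ h i) →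
      (∀ i l γ' δ, i ≠ l → MixedBound 𝕜 n (fun i => a (l.succAbove i)) γ' →
        ∑ i, a i - a l ≤ 1 / 2 → min (1 / 2) (8 / 5 * (1 / 2 - (∑ i, a i - a l))) ≤ δ →
        (∑ i, a i - a l - 1 / 2) * h i + a l * h l + (1 / 2 - ∑ i, a i) * H + L
          ≤ (γ' + δ) * Real.log 2 + b) →
      L ≤ γ * Real.log 2 + b) :
    CoeffBound 𝕜 n a γ := by
  intro t B hB ht
  set c := 1 - ∑ i, a i with hc
  have hc0 : 0 < c := by linarith
  have hM0 : 0 ≤ ∑ i, ‖t i‖ ^ (1 / c) :=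
    Finset.sum_nonneg fun x _ => Real.rpow_nonneg (norm_nonneg _) _
  rcases hM0.eq_or_lt with h0 | hM
  · rw [← h0, Real.zero_rpow hc0.ne']; positivity
  have hqs := coeffDist_mem_stdSimplex hM
  have hqn := norm_eq_mul_coeffDist hc0 hM
  set M := ∑ i, ‖t i‖ ^ (1 / c) with hMdef
  set q := coeffDist t c
  have hqt : ∀ j, q j ≠ 0 → t j ≠ 0 := by
    intro j hj h0
    have := hqn j
    rw [h0, norm_zero, eq_comm, Real.rpow_eq_zero (mul_nonneg hM0 (hqs.1 j)) hc0.ne'] at this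
    exact (mul_ne_zero hM.ne' hj) this
  have hlog : ∑ j, q j * Real.log ‖t j‖
      = c * ∑ j, q j * Real.log (q j) + c * Real.log M := by
    have : ∀ j, q j * Real.log ‖t j‖ = c * (q j * Real.log (q j)) + q j * (c * Real.log M) := by
      intro j
      by_cases hj : q j = 0
      · simp [hj]
      · have hqj : 0 < q j := lt_of_le_of_ne (hqs.1 j) (Ne.symm hj)
        rw [hqn j, Real.log_rpow (by positivity), Real.log_mul hM.ne' hj]
        ring
    rw [Finset.sum_congr rfl fun j _ => this j]
    simp only [Finset.sum_add_distrib, ← Finset.mul_sum, ← Finset.sum_mul]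
    rw [hqs.2, one_mul]
  have key := h (Real.log B) (c * Real.log M) (∑ j, q j * Real.log (q j)) (coordLog q)
    (sum_mul_log_le_coordLog hqs.1) (by
      intro i l γ' δ hil hmix hl hδ
      have := entropy_inequality ha hil hmix hl hδ hB ht hqs hqt
      rw [hlog] at this
      linarith)
  rw [← Real.log_le_log_iff (by positivity) (by positivity), Real.log_rpow hM,
    Real.log_mul (by positivity) (by positivity), Real.log_rpow two_pos]
  exact key

/-- For bilinear forms the constant of a single entropy inequality can be too large. The two
inequalities are averaged instead, with weights `1 - 2 a l` and `2 a l`, where `a l` is the larger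
exponent; the entropy of the `l`-th marginal then cancels, and that of the other one contributes
with the right sign. -/
theorem coeffBound_two {a : Fin 2 → ℝ} (ha : ∀ i, 0 ≤ a i) (ha₂ : ∀ i, a i ≤ 1 / 2)
    (hA₁ : 1 / 2 ≤ ∑ i, a i) (hA₂ : ∑ i, a i < 1) : CoeffBound 𝕜 n a (1 - ∑ i, a i) := by
  have hmix : ∀ l : Fin 2, MixedBound 𝕜 n (fun i : Fin 1 => a (l.succAbove i)) 0 := fun l =>
    mixedBound_one (ha _) ((ha₂ _).trans_lt (by norm_num))
  refine coeffBound_of_entropy ha hA₂ fun b L H h hH hent => ?_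
  obtain ⟨i, l, hil, hle, hsum⟩ : ∃ i l : Fin 2, i ≠ l ∧ a i ≤ a l ∧ ∑ i, a i = a i + a l := by
    rcases le_total (a 0) (a 1) with h | h
    · exact ⟨0, 1, by decide, h, Fin.sum_univ_two a⟩
    · exact ⟨1, 0, by decide, h, by rw [Fin.sum_univ_two, add_comm]⟩
  have h1 := hent i l 0 _ hil (hmix l) (by rw [hsum]; linarith [ha₂ i]) (min_le_right _ _)
  have h2 := hent l i 0 _ hil.symm (hmix i) (by rw [hsum]; linarith [ha₂ l]) (min_le_right _ _)
  rw [hsum] at h1 h2 hA₁ ⊢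
  have hHi := hH i
  have hai := ha i
  have hal := ha₂ l
  obtain ⟨α, hα⟩ : ∃ α, a i = 1 / 2 - α := ⟨1 / 2 - a i, by ring⟩
  obtain ⟨β, hβ⟩ : ∃ β, a l = 1 / 2 - β := ⟨1 / 2 - a l, by ring⟩
  rw [hα, hβ] at h1 h2 hA₁ hle ⊢
  rw [hα] at hai
  rw [hβ] at hal
  have hβ0 : 0 ≤ β := by linarith
  have hβ1 : 0 ≤ 1 - 2 * β := by linarith
  have hlog := Real.log_nonneg one_le_two
  -- affine in `α`, so it suffices to check the endpoints `α = β` and `α = 1 / 2`; the coefficient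
  -- of `α` changes sign at `β = 5 / 16`
  have hcost : 8 / 5 * (β * (1 + 2 * (α - β))) ≤ α + β := by
    have hα2 : α ≤ 1 / 2 := by linarith
    rcases le_total β (5 / 16) with hb | hb
    · nlinarith [mul_nonneg (show 0 ≤ α - β by linarith) (show 0 ≤ 5 / 16 - β by linarith)]
    · nlinarith [mul_nonneg (show 0 ≤ 1 / 2 - α by linarith) (show 0 ≤ β - 5 / 16 by linarith),
        sq_nonneg (β - 11 / 32)]
  have m1 := mul_le_mul_of_nonneg_left h1 (show 0 ≤ 2 * β by linarith)
  have m2 := mul_le_mul_of_nonneg_left h2 hβ1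
  have m3 := mul_le_mul_of_nonneg_right hcost hlog
  have m4 := mul_nonneg (show 0 ≤ 1 / 2 - (α + β) by linarith) (sub_nonneg.2 hHi)
  linarith

/-- For at least three variables the index `i` with the largest marginal entropy is used. The
minimality of the set of variables is what keeps the total cost below `(m + 2) (1 - ∑ a)`. -/
theorem coeffBound_add_three {a : Fin (m + 3) → ℝ} (ha : ∀ i, 0 ≤ a i)
    (hmin : ∀ i, ∑ i, a i - a i ≤ 1 / 2) (hA₁ : 1 / 2 ≤ ∑ i, a i) (hA₂ : ∑ i, a i < 1) :
    CoeffBound 𝕜 n a ((m + 2) * (1 - ∑ i, a i)) := by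
  refine coeffBound_of_entropy ha hA₂ fun b L H h hH hent => ?_
  obtain ⟨i, -, hi⟩ := Finset.exists_min_image Finset.univ h ⟨0, Finset.mem_univ 0⟩
  -- minimality, read as a lower bound for each exponent
  have hμ : ∀ i, ∑ i, a i - 1 / 2 ≤ a i := fun i => by linarith [hmin i]
  obtain ⟨l, hil, hl⟩ := exists_ne_mul_le_sum_sub hμ i
  have hs : ∑ i, a (l.succAbove i) = ∑ i, a i - a l := by
    rw [Fin.sum_univ_succAbove a l]; ring
  have hmix := mixedBound_add_two (𝕜 := 𝕜) (n := n) (a := fun i => a (l.succAbove i))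
    (μ := ∑ i, a i - 1 / 2) (by linarith) (fun i => hμ _) (by rw [hs]; exact hmin l)
  have key := hent i l _ (2 * (1 / 2 - (∑ i, a i - a l))) hil hmix (hmin l)
    ((min_le_right _ _).trans (by linarith [hmin l]))
  rw [hs] at key
  have k1 := mul_nonneg (ha l) (sub_nonneg.2 (hi l (Finset.mem_univ l)))
  have k2 := mul_nonneg (show 0 ≤ ∑ i, a i - 1 / 2 by linarith) (sub_nonneg.2 (hH i))
  have hm : (0 : ℝ) ≤ m := Nat.cast_nonneg m
  have hcost : 1 / 2 + m * (1 - (∑ i, a i - 1 / 2) - (∑ i, a i - a l))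
      + 2 * (1 / 2 - (∑ i, a i - a l)) ≤ (m + 2) * (1 - ∑ i, a i) := by
    push_cast at hl
    nlinarith [mul_nonneg hm (show 0 ≤ ∑ i, a i - 1 / 2 by linarith)]
  have k3 := mul_le_mul_of_nonneg_right hcost (Real.log_nonneg one_le_two)
  linarith

/-- The last hypothesis on `S` is a weak form of minimality among the admissible sets. Variables
outside `S` are removed one by one, until `S` is the whole index set. -/
theorem coeffBound_of_minimal : ∀ {m : ℕ} {a : Fin m → ℝ} (_ : ∀ i, 0 ≤ a i) (_ : ∑ i, a i < 1)
    {S : Finset (Fin m)} (_ : 1 / 2 ≤ ∑ i ∈ S, a i) (_ : ∀ k ∈ S, ∑ i ∈ S, a i - a k ≤ 1 / 2),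
    CoeffBound 𝕜 n a (((S.card : ℝ) - 1) * (1 - ∑ i ∈ S, a i)) := by
  intro m
  induction m with
  | zero =>
    intro a _ _ S hS
    rw [Finset.eq_empty_of_isEmpty S, Finset.sum_empty] at hS
    norm_num at hS
  | succ m ih =>
    intro a ha hA S hS hmin
    by_cases huniv : S = Finset.univ
    · subst huniv
      simp only [Finset.mem_univ, forall_const] at hmin
      rw [Finset.card_univ, Fintype.card_fin]
      match m with
      | 0 =>
        have := coeffBound_one (𝕜 := 𝕜) (n := n) (ha 0) (by rwa [Fin.sum_univ_one] at hA)
        simpa using this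
      | 1 =>
        have h0 := hmin 0
        have h1 := hmin 1
        have := coeffBound_two (𝕜 := 𝕜) (n := n) ha (by
          rw [Fin.sum_univ_two] at h0 h1
          intro i
          fin_cases i
          · simp only [Fin.zero_eta]; linarith
          · simp only [Fin.mk_one]; linarith) hS hA
        convert this using 1
        push_cast
        ring
      | m + 2 =>
        have := coeffBound_add_three (𝕜 := 𝕜) (n := n) ha hmin hS hA
        convert this using 1
        push_cast
        ring
    · obtain ⟨l, hl⟩ : ∃ l, l ∉ S := by
        by_contra! hall
        exact huniv (Finset.eq_univ_iff_forall.2 hall)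
      obtain ⟨S', rfl⟩ : ∃ S' : Finset (Fin m), S'.map l.succAboveEmb = S := by
        refine ⟨Finset.univ.filter fun i => l.succAbove i ∈ S, ?_⟩
        ext k
        simp only [Finset.mem_map, Finset.mem_filter, Finset.mem_univ, true_and,
          Fin.coe_succAboveEmb]
        constructor
        · rintro ⟨i, hi, rfl⟩; exact hi
        · intro hk
          obtain ⟨i, rfl⟩ := Fin.exists_succAbove_eq (x := k) (y := l)
            (fun h => hl (h ▸ hk))
          exact ⟨i, hk, rfl⟩
      simp only [Finset.sum_map, Finset.card_map, Fin.coe_succAboveEmb] at hS hmin ⊢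
      have hs : ∑ i, a i = a l + ∑ i, a (l.succAbove i) := Fin.sum_univ_succAbove a l
      have hS' : ∑ i ∈ S', a (l.succAbove i) ≤ ∑ i, a (l.succAbove i) :=
        Finset.sum_le_sum_of_subset_of_nonneg (Finset.subset_univ _) fun i _ _ => ha _
      have hal := ha l
      exact CoeffBound.add_variable l hal hA (hS.trans hS')
        (ih (fun i => ha _) (by linarith) hS fun k hk =>
          hmin _ (Finset.mem_map_of_mem l.succAboveEmb hk))

end Coefficients

/-! ### Multilinear forms on products of `ℓ_p` spaces -/

theorem norm_le_one_of_le_rpow {𝕜 : Type*} [RCLike 𝕜] {n : ℕ} {p : ℝ≥0∞} (hp : 1 < p)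
    {w : Fin n → ℝ} (hw : w ∈ stdSimplex ℝ (Fin n)) {z : Fin n → 𝕜}
    (hz : ∀ x, ‖z x‖ ≤ w x ^ (p⁻¹).toReal) :
    ‖(WithLp.toLp p z : PiLp p fun _ : Fin n => 𝕜)‖ ≤ 1 := by
  rcases eq_or_ne p ⊤ with rfl | hp'
  · rw [PiLp.norm_eq_ciSup]
    exact Real.iSup_le (fun x => by simpa using hz x) zero_le_one
  · have hp0 : 0 < p.toReal := ENNReal.toReal_pos (zero_lt_one.trans hp).ne' hp'
    rw [PiLp.norm_eq_sum hp0]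
    refine Real.rpow_le_one (Finset.sum_nonneg fun x _ => Real.rpow_nonneg (norm_nonneg _) _) ?_
      (by positivity)
    rw [← hw.2]
    refine Finset.sum_le_sum fun x _ => ?_
    calc ‖z x‖ ^ p.toReal ≤ (w x ^ (p⁻¹).toReal) ^ p.toReal := by gcongr; exact hz x
      _ = w x := by
        rw [← Real.rpow_mul (hw.1 x), ENNReal.toReal_inv, inv_mul_cancel₀ hp0.ne', Real.rpow_one]

theorem formBound_formNorm {𝕜 : Type*} [RCLike 𝕜] {m n : ℕ} {p : Fin m → ℝ≥0∞}
    (hp : ∀ k, 1 < p k)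
    (T : MultilinearMap 𝕜 (fun k : Fin m => PiLp (p k) (fun _ : Fin n => 𝕜)) 𝕜) :
    FormBound (fun k => ((p k)⁻¹).toReal) (fun j => T fun k => stdVec 𝕜 (p k) (j k))
      (formNorm T) := by
  intro w z hw hz
  refine le_csSup (formNorm_bddAbove hp T) ⟨fun k => WithLp.toLp (p k) (z k),
    fun k => norm_le_one_of_le_rpow (hp k) (hw k) (hz k), congrArg norm ?_⟩
  have hexp : (fun k => (WithLp.toLp (p k) (z k) : PiLp (p k) fun _ : Fin n => 𝕜))
      = fun k => ∑ j : Fin n, z k j • stdVec 𝕜 (p k) j := by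
    funext k
    ext i
    simp [stdVec, Pi.single_apply]
  rw [hexp, MultilinearMap.map_sum]
  refine Finset.sum_congr rfl fun j _ => ?_
  rw [MultilinearMap.map_smul_univ, smul_eq_mul, mul_comm]

theorem FormBound.mono {𝕜 : Type*} [RCLike 𝕜] {m n : ℕ} {a : Fin m → ℝ}
    {t : (Fin m → Fin n) → 𝕜} {B B' : ℝ} (h : FormBound a t B) (hB : B ≤ B') : FormBound a t B' :=
  fun w z hw hz => (h w z hw hz).trans hB

theorem formNorm_nonneg {𝕜 : Type*} [RCLike 𝕜] {m n : ℕ} {p : Fin m → ℝ≥0∞}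
    (T : MultilinearMap 𝕜 (fun k : Fin m => PiLp (p k) (fun _ : Fin n => 𝕜)) 𝕜) :
    0 ≤ formNorm T :=
  Real.sSup_nonneg (by rintro r ⟨x, -, rfl⟩; exact norm_nonneg _)

theorem mainTheorem1 {𝕜 : Type*} [RCLike 𝕜] (m : ℕ) (hm : 2 ≤ m)
    (p : Fin m → ℝ≥0∞) (hp : ∀ k, 1 < p k)
    (hp₁ : 1 / 2 ≤ recipSum p Finset.univ) (hp₂ : recipSum p Finset.univ < 1)
    (s : ℕ) (hs : IsLeast (admissibleSizes p) s)
    (S : Finset (Fin m)) (hS : S.card = s)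
    (hS₁ : 1 / 2 ≤ recipSum p S) (hS₂ : recipSum p S < 1)
    (n : ℕ) (hn : 1 ≤ n)
    (T : MultilinearMap 𝕜 (fun k : Fin m => PiLp (p k) (fun _ : Fin n => 𝕜)) 𝕜) :
    (∑ j : Fin m → Fin n, ‖T (fun k => stdVec 𝕜 (p k) (j k))‖ ^
        (1 / (1 - recipSum p Finset.univ))) ^ (1 - recipSum p Finset.univ) ≤
      (2 : ℝ) ^ (((s : ℝ) - 1) * (1 - recipSum p S)) * formNorm T := by
  subst hS
  have ha : ∀ k, 0 ≤ ((p k)⁻¹).toReal := fun k => ENNReal.toReal_nonneg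
  have hmin : ∀ k ∈ S, recipSum p S - ((p k)⁻¹).toReal ≤ 1 / 2 := by
    intro k hk
    have he : recipSum p (S.erase k) = recipSum p S - ((p k)⁻¹).toReal :=
      Finset.sum_erase_eq_sub hk
    by_contra! hlt
    have h1 := ha k
    have := hs.2 ⟨S.erase k, rfl, by rw [he]; exact hlt.le, by rw [he]; linarith⟩
    exact absurd this (not_le.2 (Finset.card_erase_lt_of_mem hk))
  have hC := coeffBound_of_minimal (𝕜 := 𝕜) (n := n) ha hp₂ (S := S) hS₁ hmin
  have h2 : (0 : ℝ) < 2 ^ (((S.card : ℝ) - 1) * (1 - recipSum p S)) := by positivity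
  -- `formNorm T` may vanish, so the bound is applied to all larger numbers
  rw [mul_comm, ← div_le_iff₀ h2]
  refine le_of_forall_gt_imp_ge_of_dense fun B hB => ?_
  rw [div_le_iff₀ h2, mul_comm]
  exact hC _ B ((formNorm_nonneg T).trans_lt hB) ((formBound_formNorm hp T).mono hB.le)
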